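/- Let $n\ge 0$, $m\ge 1$, and let $S_1,\dots,S_m:\mathbb R^n\to\mathbb R^n$ be contraction similitudes, $|S_i(x)-S_i(y)|=c_i|x-y|$ with $0<c_i<1$. Let $E$ be the nonempty compact set with $E=\bigcup_{i=1}^m S_i(E)$, and let $r(E)=\inf_{x\in\mathbb R^n}\sup_{a\in E}|x-a|$ be its radius. Let $\mathcal I$ be the set of all finite words $\mathbf i=i_1\cdots i_k$ ($k\ge 0$) over $\{1,\dots,m\}$, and put $S_{\mathbf i}=S_{i_1}\circ\cdots\circ S_{i_k}$, $E_{\mathbf i}=S_{\mathbf i}(E)$, $c_{\mathbf i}=c_{i_1}\cdots c_{i_k}$ (the identity, $E$ and $1$ for the empty word). For nonempty $A,B\subseteq\mathbb R^n$ let the shape difference $\tilde h(A,B)$ be the infimum of the Hausdorff distances $h(\varphi(A),\psi(B))$ over all isometries $\varphi,\psi$ of $\mathbb R^n$. Let $(F_{\mathbf i})_{\mathbf i\in\mathcal I}$ be nonempty compact subsets of $\mathbb R^n$ with $F_{\mathbf i}=\bigcup_{i=1}^m F_{\mathbf i i}$ for all $\mathbf i\in\mathcal I$, where $\mathbf i i$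 is the word $\mathbf i$ followed by the letter $i$, and let $F$ be the set $F_{\mathbf i}$ for the empty word $\mathbf i$. Suppose that $F$ is a $\delta$-quasi-self-similar set, $\delta<\infty$: there are real numbers $\delta_{\mathbf i}\ge 0$ with $\sup_{\mathbf i}\delta_{\mathbf i}=\delta$ and $$\tilde h(F_{\mathbf i},E_{\mathbf i})\le \delta_{\mathbf i}\,c_{\mathbf i}\,r(E)\qquad(\mathbf i\in\mathcal I).$$ Suppose also that the open set condition holds: there are open sets $V_{\mathbf i}\subseteq\mathbb R^n$ ($\mathbf i\in\mathcal I$) such that (1) $F_{\mathbf i}\subseteq\overline{V_{\mathbf i}}$ for all $\mathbf i$; (2) $V_{\mathbf i}\cap V_{\mathbf j}=\emptyset$ whenever no infinite word begins with both $\mathbf i$ and $\mathbf j$; (3) there are constants $a_1,a_2>0$ such that every $V_{\mathbf i}$ contains a ball of radius $a_1c_{\mathbf i}$ and is contained in a ball of radius $a_2c_{\mathbf i}$. Let $s$ be the similarity dimension, i.e. the real number with $\sum_{i=1}^m c_i^s=1$. Then $$\dim_H F=\dim_B F=s\qquad\text{and}\qquad 0<\mathcal H^s(F)<\infty,$$ where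 $\dim_H$ is the Hausdorff dimension, $\mathcal H^s$ is the $s$-dimensional Hausdorff measure, and $\dim_B F=s$ means that the lower and upper box dimensions, $\liminf$ and $\limsup$ as $r\to0^+$ of $\log N(r)/(-\log r)$ with $N(r)$ the least number of sets of diameter at most $r$ covering $F$, both equal $s$. -/

import Mathlib

open Set Filter Topology MeasureTheory
open scoped NNReal ENNReal

noncomputable section

namespace ShapePerturbation

/-- The shape difference of two sets: the infimum of the Hausdorff distances
`h (φ A) (ψ B)` over all isometries `φ`, `ψ` of the ambient space. -/
def shapeDifference {X : Type*} [PseudoEMetricSpace X] (A B : Set X) : ℝ≥0∞ :=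
  ⨅ (φ : X → X) (ψ : X → X) (_ : Isometry φ) (_ : Isometry ψ),
    Metric.hausdorffEDist (φ '' A) (ψ '' B)

/-- The radius of a set: `inf_x sup_{a ∈ A} d (x, a)`. -/
def radius {X : Type*} [PseudoEMetricSpace X] (A : Set X) : ℝ≥0∞ :=
  ⨅ x : X, ⨆ a ∈ A, edist x a

/-- The smallest number of sets of diameter at most `r` which cover `A`
(`⊤` if there is no finite cover of this kind). -/
def coverCount {X : Type*} [PseudoEMetricSpace X] (A : Set X) (r : ℝ) : ℕ∞ :=
  ⨅ (𝒰 : Finset (Set X)) (_ : A ⊆ ⋃ U ∈ 𝒰, U)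
    (_ : ∀ U ∈ 𝒰, Metric.ediam U ≤ ENNReal.ofReal r), (𝒰.card : ℕ∞)

/-- The lower box dimension `liminf_{r → 0+} log N(r) / (- log r)`. -/
def lowerBoxDim {X : Type*} [PseudoEMetricSpace X] (A : Set X) : EReal :=
  liminf (fun r : ℝ => ENNReal.log (coverCount A r : ℝ≥0∞) / ((-Real.log r : ℝ) : EReal))
    (𝓝[>] (0 : ℝ))

/-- The upper box dimension `limsup_{r → 0+} log N(r) / (- log r)`. -/
def upperBoxDim {X : Type*} [PseudoEMetricSpace X] (A : Set X) : EReal :=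
  limsup (fun r : ℝ => ENNReal.log (coverCount A r : ℝ≥0∞) / ((-Real.log r : ℝ) : EReal))
    (𝓝[>] (0 : ℝ))

/-- `A` has box dimension `t`: the lower and the upper box dimension both equal `t`. -/
def HasBoxDim {X : Type*} [PseudoEMetricSpace X] (A : Set X) (t : EReal) : Prop :=
  lowerBoxDim A = t ∧ upperBoxDim A = t

/-- An iterated function system of `m` contraction similitudes of `ℝⁿ`, with their ratios. -/
structure IFSS (n m : ℕ) where
  /-- the similitudes -/
  map : Fin m → EuclideanSpace ℝ (Fin n) → EuclideanSpace ℝ (Fin n)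
  /-- the ratios (Lipschitz constants) -/
  ratio : Fin m → ℝ
  ratio_pos : ∀ i, 0 < ratio i
  ratio_lt_one : ∀ i, ratio i < 1
  dist_map : ∀ i x y, dist (map i x) (map i y) = ratio i * dist x y

namespace IFSS

variable {n m : ℕ}

/-- `S_w = S_{i₁} ∘ ⋯ ∘ S_{i_k}` for the word `w = i₁ ⋯ i_k`; the identity for the empty word. -/
def wordMap (S : IFSS n m) : List (Fin m) → EuclideanSpace ℝ (Fin n) → EuclideanSpace ℝ (Fin n)
  | [] => id
  | i :: w => S.map i ∘ S.wordMap w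

/-- `c_w = c_{i₁} ⋯ c_{i_k}` for the word `w = i₁ ⋯ i_k`; `1` for the empty word. -/
def wordRatio (S : IFSS n m) (w : List (Fin m)) : ℝ := (w.map S.ratio).prod

/-- `E` is the (nonempty) compact invariant set of the system `S`. -/
structure IsInvariantSet (S : IFSS n m) (E : Set (EuclideanSpace ℝ (Fin n))) : Prop where
  isCompact : IsCompact E
  nonempty : E.Nonempty
  iUnion_image : ⋃ i, S.map i '' E = E

end IFSS

/-- The set of infinite words which begin with the finite word `w`. -/
def cylinder {m : ℕ} (w : List (Fin m)) : Set (ℕ → Fin m) :=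
  {α | ∀ k : Fin w.length, α k = w.get k}

/-- `𝓕` is a structure system of `F`: nonempty compact sets indexed by the finite words,
each the union of its children, with `F` at the empty word. -/
structure IsStructureSystem {n m : ℕ} (𝓕 : List (Fin m) → Set (EuclideanSpace ℝ (Fin n)))
    (F : Set (EuclideanSpace ℝ (Fin n))) : Prop where
  isCompact : ∀ w, IsCompact (𝓕 w)
  nonempty : ∀ w, (𝓕 w).Nonempty
  eq_iUnion : ∀ w, 𝓕 w = ⋃ i : Fin m, 𝓕 (w ++ [i])
  root : 𝓕 [] = F

/-- `F`, with the structure system `𝓕`, is a `Δ`-perturbation of the self-similar set `E` of `S`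
(a `Δ`-quasi-self-similar set). -/
structure IsPerturbation {n m : ℕ} (S : IFSS n m) (E F : Set (EuclideanSpace ℝ (Fin n)))
    (𝓕 : List (Fin m) → Set (EuclideanSpace ℝ (Fin n))) (Δ : List (Fin m) → ℝ≥0) : Prop where
  invariant : S.IsInvariantSet E
  structureSystem : IsStructureSystem 𝓕 F
  shapeDifference_le : ∀ w, shapeDifference (𝓕 w) (S.wordMap w '' E) ≤
    (Δ w : ℝ≥0∞) * ENNReal.ofReal (S.wordRatio w) * radius E

/-- `F`, with the structure system `𝓕`, is a `δ`-quasi-self-similar set with the system `S`: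
it is a `Δ`-perturbation of the invariant set `E` of `S` for some family `Δ` with
(finite) supremum `δ`. -/
def IsQuasiSelfSimilar {n m : ℕ} (S : IFSS n m) (E F : Set (EuclideanSpace ℝ (Fin n)))
    (𝓕 : List (Fin m) → Set (EuclideanSpace ℝ (Fin n))) (δ : ℝ≥0) : Prop :=
  ∃ Δ : List (Fin m) → ℝ≥0, IsLUB (range Δ) δ ∧ IsPerturbation S E F 𝓕 Δ

/-- The open set condition for a structure system `𝓕`, relative to the ratios of `S`. -/
def OpenSetCondition {n m : ℕ} (S : IFSS n m)
    (𝓕 : List (Fin m) → Set (EuclideanSpace ℝ (Fin n))) : Prop :=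
  ∃ V : List (Fin m) → Set (EuclideanSpace ℝ (Fin n)),
    (∀ w, IsOpen (V w)) ∧
    (∀ w, 𝓕 w ⊆ closure (V w)) ∧
    (∀ v w, cylinder v ∩ cylinder w = ∅ → V v ∩ V w = ∅) ∧
    ∃ a₁ a₂ : ℝ, 0 < a₁ ∧ 0 < a₂ ∧ ∀ w,
      (∃ x, Metric.ball x (a₁ * S.wordRatio w) ⊆ V w) ∧
      (∃ y, V w ⊆ Metric.closedBall y (a₂ * S.wordRatio w))

end ShapePerturbation

end

noncomputable section

namespace ShapePerturbation

/-! Write c_w for `S.wordRatio w`. The perturbation hypothesis enters only through the bound diam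
F_w ≤ K c_w (`IsQuasiSelfSimilar.exists_ediam_le`); the rest is Moran's argument for sets coded by
words.

Fix a scale ρ < 1 and stop each infinite word at its first prefix w with c_w ≤ ρ. The stopping
cylinders are disjoint, and the Bernoulli measure with letter weights c_i^s gives them mass c_w^s,
so these sum to at most 1. The pieces F_w cover F with diameters at most Kρ. Hence the s-dimensional
Hausdorff measure is at most K^s, and O(ρ^(-s)) pieces suffice.

For the lower bounds, push the Bernoulli measure to F by the coding map. By the open set condition
and a volume comparison, a set of diameter at most ρ meets a bounded number of stopping pieces
(`OpenSetCondition.exists_card_le`), so its mass is at most Cρ^s (`exists_measure_le_of_ediam_le`).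
This gives positive Hausdorff measure and at least r^(-s)/C covering sets. -/

/-- The finite word formed by the first `k` letters of the infinite word `α`. -/
def wordPrefix {m : ℕ} (α : ℕ → Fin m) (k : ℕ) : List (Fin m) := (List.range k).map α

/-! ### Prefixes and cylinders. -/

section Words

variable {m : ℕ}

@[simp] lemma wordPrefix_zero (α : ℕ → Fin m) : wordPrefix α 0 = [] := rfl

@[simp] lemma length_wordPrefix (α : ℕ → Fin m) (k : ℕ) : (wordPrefix α k).length = k := by
  simp [wordPrefix]

lemma wordPrefix_succ (α : ℕ → Fin m) (k : ℕ) :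
    wordPrefix α (k + 1) = wordPrefix α k ++ [α k] := by
  simp [wordPrefix, List.range_succ]

lemma wordPrefix_congr {α β : ℕ → Fin m} {k : ℕ} (h : ∀ j < k, α j = β j) :
    wordPrefix α k = wordPrefix β k := by
  simpa [wordPrefix] using h

lemma mem_cylinder_iff {α : ℕ → Fin m} {w : List (Fin m)} :
    α ∈ cylinder w ↔ wordPrefix α w.length = w := by
  constructor
  · intro h
    refine List.ext_get (by simp) fun k h₁ h₂ => ?_
    have := h ⟨k, h₂⟩
    simpa [wordPrefix] using this
  · intro h k
    have h₁ : (k : ℕ) < (wordPrefix α w.length).length := by simp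
    have : (wordPrefix α w.length)[(k : ℕ)]'h₁ = w[(k : ℕ)] := by simp only [h]
    simpa [wordPrefix] using this

lemma mem_cylinder_wordPrefix (α : ℕ → Fin m) (k : ℕ) : α ∈ cylinder (wordPrefix α k) := by
  simp [mem_cylinder_iff]

/-- Product form required by `Measure.infinitePi_pi`; the default of `getD` is never read, as k
stays below the length. -/
lemma cylinder_eq_pi [Nonempty (Fin m)] (w : List (Fin m)) :
    cylinder w = Set.pi (Finset.range w.length)
      fun k => {w.getD k (Classical.arbitrary (Fin m))} := by
  ext α
  simp only [cylinder, Set.mem_pi, Finset.coe_range, mem_Iio, mem_singleton_iff]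
  constructor
  · intro h k hk
    have := h ⟨k, hk⟩
    simp_all
  · intro h k
    have := h k k.2
    simp_all

lemma measurableSet_cylinder (w : List (Fin m)) : MeasurableSet (cylinder w) := by
  have : cylinder w = ⋂ k : Fin w.length, (fun α : ℕ → Fin m => α k) ⁻¹' {w.get k} := by
    ext α
    simp [cylinder]
  rw [this]
  exact .iInter fun k => measurable_pi_apply _ (measurableSet_singleton _)

end Words

/-! ### Ratios, stopping words and the Bernoulli measure. -/

namespace IFSS

variable {n m : ℕ} (S : IFSS n m)

@[simp] lemma wordRatio_nil : S.wordRatio [] = 1 := rfl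

@[simp] lemma wordRatio_concat (w : List (Fin m)) (i : Fin m) :
    S.wordRatio (w ++ [i]) = S.wordRatio w * S.ratio i := by
  simp [wordRatio]

lemma wordRatio_cons (i : Fin m) (w : List (Fin m)) :
    S.wordRatio (i :: w) = S.ratio i * S.wordRatio w := by
  simp [wordRatio]

lemma wordRatio_pos (w : List (Fin m)) : 0 < S.wordRatio w := by
  induction w with
  | nil => simp
  | cons i w ih => rw [wordRatio_cons]; exact mul_pos (S.ratio_pos i) ih

lemma edist_wordMap (w : List (Fin m)) (x y : EuclideanSpace ℝ (Fin n)) :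
    edist (S.wordMap w x) (S.wordMap w y) = ENNReal.ofReal (S.wordRatio w) * edist x y := by
  induction w with
  | nil => simp [wordMap]
  | cons i w ih =>
    rw [wordRatio_cons, ENNReal.ofReal_mul (S.ratio_pos i).le, mul_assoc, ← ih]
    simp only [wordMap, Function.comp_apply]
    rw [edist_dist, S.dist_map, ENNReal.ofReal_mul (S.ratio_pos i).le, edist_dist]

lemma ediam_wordMap_image_le (w : List (Fin m)) (A : Set (EuclideanSpace ℝ (Fin n))) :
    Metric.ediam (S.wordMap w '' A) ≤ ENNReal.ofReal (S.wordRatio w) * Metric.ediam A := by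
  refine Metric.ediam_le ?_
  rintro _ ⟨x, hx, rfl⟩ _ ⟨y, hy, rfl⟩
  rw [edist_wordMap]
  gcongr
  exact Metric.edist_le_ediam_of_mem hx hy

lemma antitone_wordRatio_wordPrefix (α : ℕ → Fin m) :
    Antitone fun k => S.wordRatio (wordPrefix α k) := by
  refine antitone_nat_of_succ_le fun k => ?_
  rw [wordPrefix_succ, wordRatio_concat]
  exact mul_le_of_le_one_right (S.wordRatio_pos _).le (S.ratio_lt_one _).le

lemma tendsto_wordRatio_wordPrefix (α : ℕ → Fin m) :
    Tendsto (fun k => S.wordRatio (wordPrefix α k)) atTop (𝓝 0) := by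
  have : Nonempty (Fin m) := ⟨α 0⟩
  obtain ⟨i, hi⟩ := Finite.exists_max S.ratio
  refine squeeze_zero (fun k => (S.wordRatio_pos _).le) (fun k => ?_)
    (tendsto_pow_atTop_nhds_zero_of_lt_one (S.ratio_pos i).le (S.ratio_lt_one i))
  induction k with
  | zero => simp
  | succ k ih =>
    rw [wordPrefix_succ, wordRatio_concat, pow_succ]
    exact mul_le_mul ih (hi _) (S.ratio_pos _).le (pow_pos (S.ratio_pos i) k).le

/-- The words whose ratio is at most `ρ`, while that of their parent exceeds `ρ`. -/
def stoppingWords (ρ : ℝ) : Set (List (Fin m)) :=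
  {w | ∃ v i, w = v ++ [i] ∧ S.wordRatio w ≤ ρ ∧ ρ < S.wordRatio v}

lemma exists_wordPrefix_mem_stoppingWords (α : ℕ → Fin m) {ρ : ℝ} (h₀ : 0 < ρ) (h₁ : ρ < 1) :
    ∃ k, wordPrefix α k ∈ S.stoppingWords ρ := by
  have hex : ∃ k, S.wordRatio (wordPrefix α k) ≤ ρ :=
    (((S.tendsto_wordRatio_wordPrefix α).eventually_lt_const h₀).mono fun _ h => h.le).exists
  classical
  rcases hk : Nat.find hex with _ | k
  -- The empty word has no parent; it is excluded because its ratio 1 exceeds ρ.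
  · have := Nat.find_spec hex
    rw [hk] at this
    simp only [wordPrefix_zero, wordRatio_nil] at this
    exact absurd h₁ this.not_gt
  · refine ⟨k + 1, wordPrefix α k, α k, wordPrefix_succ α k, ?_, ?_⟩
    · have := Nat.find_spec hex
      rwa [hk] at this
    · exact not_le.1 (Nat.find_min hex (by rw [hk]; exact k.lt_succ_self))

/-- Two words with a common extension are prefixes of it. If v were the shorter, it would be a
prefix of the parent u of w, so c_u ≤ c_v ≤ ρ < c_u. -/
lemma disjoint_cylinder_of_mem_stoppingWords {ρ : ℝ} {v w : List (Fin m)}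
    (hv : v ∈ S.stoppingWords ρ) (hw : w ∈ S.stoppingWords ρ) (hne : v ≠ w) :
    Disjoint (cylinder v) (cylinder w) := by
  have key : ∀ {v w : List (Fin m)} {α : ℕ → Fin m}, v ∈ S.stoppingWords ρ →
      w ∈ S.stoppingWords ρ → α ∈ cylinder v → α ∈ cylinder w → ¬ v.length < w.length := by
    rintro v _ α ⟨-, -, -, hvρ, -⟩ ⟨u, i, rfl, -, huρ⟩ hαv hαw hlt
    rw [mem_cylinder_iff] at hαv hαw
    simp only [List.length_append, List.length_singleton, wordPrefix_succ] at hαw hlt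
    have hu := (List.append_inj hαw (by simp)).1
    have := S.antitone_wordRatio_wordPrefix α (Nat.lt_succ_iff.1 hlt)
    simp only [hαv, hu] at this
    linarith
  refine Set.disjoint_left.2 fun α hαv hαw => hne ?_
  have := le_antisymm (not_lt.1 (key hw hv hαw hαv)) (not_lt.1 (key hv hw hαv hαw))
  rw [← mem_cylinder_iff.1 hαv, ← mem_cylinder_iff.1 hαw, this]

lemma exists_bernoulli_measure {s : ℝ} (hs : ∑ i, S.ratio i ^ s = 1) :
    ∃ P : Measure (ℕ → Fin m), IsProbabilityMeasure P ∧
      ∀ w, P (cylinder w) = ENNReal.ofReal (S.wordRatio w ^ s) := by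
  have hne : Nonempty (Fin m) := by
    by_contra h
    rw [not_nonempty_iff] at h
    simp at hs
  have hsum : ∑ i, ENNReal.ofReal (S.ratio i ^ s) = 1 := by
    rw [← ENNReal.ofReal_sum_of_nonneg fun i _ => (Real.rpow_pos_of_pos (S.ratio_pos i) s).le, hs,
      ENNReal.ofReal_one]
  let p : PMF (Fin m) := PMF.ofFintype (fun i => ENNReal.ofReal (S.ratio i ^ s)) hsum
  refine ⟨Measure.infinitePi fun _ : ℕ => p.toMeasure, inferInstance, fun w => ?_⟩
  rw [cylinder_eq_pi, Measure.infinitePi_pi _ fun _ _ => measurableSet_singleton _]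
  simp only [PMF.toMeasure_apply_singleton _ _ (measurableSet_singleton _)]
  induction w using List.reverseRecOn with
  | nil => simp
  | append_singleton w i ih =>
    rw [List.length_append, List.length_singleton, Finset.prod_range_succ, wordRatio_concat,
      Real.mul_rpow (S.wordRatio_pos w).le (S.ratio_pos i).le,
      ENNReal.ofReal_mul (Real.rpow_pos_of_pos (S.wordRatio_pos w) s).le, ← ih]
    congr 1
    · refine Finset.prod_congr rfl fun k hk => ?_
      rw [List.getD_append _ _ _ _ (Finset.mem_range.1 hk)]
    · simp [p]

lemma nonneg_of_sum_rpow_eq_one {s : ℝ} (hs : ∑ i, S.ratio i ^ s = 1) : 0 ≤ s := by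
  by_contra! h
  obtain hm | ⟨⟨i⟩⟩ := isEmpty_or_nonempty (Fin m)
  · simp at hs
  · have h₁ : S.ratio i ^ s ≤ 1 := hs ▸ Finset.single_le_sum
      (f := fun i => S.ratio i ^ s)
      (fun j _ => (Real.rpow_pos_of_pos (S.ratio_pos j) s).le) (Finset.mem_univ i)
    have := Real.one_lt_rpow_of_pos_of_lt_one_of_neg (S.ratio_pos i) (S.ratio_lt_one i) h
    linarith

/-- The ratios of the stopping words at scale `ρ` are bounded below by a multiple of `ρ`. -/
lemma exists_mul_le_wordRatio_of_mem_stoppingWords [Nonempty (Fin m)] :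
    ∃ c, 0 < c ∧ ∀ ρ, ∀ w ∈ S.stoppingWords ρ, c * ρ ≤ S.wordRatio w := by
  obtain ⟨i, hi⟩ := Finite.exists_min S.ratio
  refine ⟨S.ratio i, S.ratio_pos i, ?_⟩
  rintro ρ _ ⟨v, j, rfl, -, hv⟩
  rw [wordRatio_concat, mul_comm]
  exact mul_le_mul hv.le (hi j) (S.ratio_pos i).le (S.wordRatio_pos v).le

end IFSS

/-! ### Diameters of the pieces and the coding map. -/

lemma ediam_le_of_shapeDifference_lt {X : Type*} [PseudoEMetricSpace X] {A B : Set X} {t : ℝ≥0∞}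
    (h : shapeDifference A B < t) : Metric.ediam A ≤ Metric.ediam B + 2 * t := by
  simp only [shapeDifference, iInf_lt_iff] at h
  obtain ⟨φ, ψ, hφ, hψ, h⟩ := h
  refine Metric.ediam_le fun x hx y hy => ?_
  obtain ⟨_, ⟨x', hx', rfl⟩, hxt⟩ :=
    Metric.exists_edist_lt_of_hausdorffEDist_lt (mem_image_of_mem φ hx) h
  obtain ⟨_, ⟨y', hy', rfl⟩, hyt⟩ :=
    Metric.exists_edist_lt_of_hausdorffEDist_lt (mem_image_of_mem φ hy) h
  calc edist x y = edist (φ x) (φ y) := (hφ x y).symm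
    _ ≤ edist (φ x) (ψ x') + edist (ψ x') (ψ y') + edist (ψ y') (φ y) := edist_triangle4 ..
    _ ≤ t + Metric.ediam B + t := by
        rw [hψ x' y', edist_comm (ψ y')]
        gcongr
        exact Metric.edist_le_ediam_of_mem hx' hy'
    _ = Metric.ediam B + 2 * t := by ring

lemma radius_ne_top {X : Type*} [PseudoEMetricSpace X] {A : Set X} (hne : A.Nonempty)
    (hA : Metric.ediam A ≠ ⊤) : radius A ≠ ⊤ := by
  obtain ⟨x, hx⟩ := hne
  refine ne_top_of_le_ne_top hA ((iInf_le _ x).trans (iSup₂_le fun a ha => ?_))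
  exact Metric.edist_le_ediam_of_mem hx ha

variable {n m : ℕ} {S : IFSS n m} {E F : Set (EuclideanSpace ℝ (Fin n))}
  {𝓕 : List (Fin m) → Set (EuclideanSpace ℝ (Fin n))}

/-- The diameters of the pieces of a quasi-self-similar set are comparable to the ratios. -/
lemma IsQuasiSelfSimilar.exists_ediam_le {δ : ℝ≥0} (h : IsQuasiSelfSimilar S E F 𝓕 δ) :
    ∃ K, 0 < K ∧ ∀ w, Metric.ediam (𝓕 w) ≤ ENNReal.ofReal (K * S.wordRatio w) := by
  obtain ⟨Δ, hΔ, hP⟩ := h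
  have hE : Metric.ediam E ≠ ⊤ := hP.invariant.isCompact.isBounded.ediam_ne_top
  have hR : radius E ≠ ⊤ := radius_ne_top hP.invariant.nonempty hE
  -- The summand 1 makes `hlt` strict, even when E has radius 0, so that isometries realising the
  -- bound exist.
  refine ⟨(Metric.ediam E).toReal + 2 * (δ * (radius E).toReal + 1), by positivity, fun w => ?_⟩
  have hc := S.wordRatio_pos w
  have hlt : shapeDifference (𝓕 w) (S.wordMap w '' E) <
      ENNReal.ofReal ((δ * (radius E).toReal + 1) * S.wordRatio w) := by
    refine (hP.shapeDifference_le w).trans_lt ?_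
    rw [← ENNReal.ofReal_toReal hR, ← ENNReal.ofReal_coe_nnreal,
      ← ENNReal.ofReal_mul (Δ w).coe_nonneg, ← ENNReal.ofReal_mul (by positivity),
      ENNReal.toReal_ofReal ENNReal.toReal_nonneg]
    refine (ENNReal.ofReal_lt_ofReal_iff (by positivity)).2 ?_
    have hle : (Δ w : ℝ) ≤ δ := NNReal.coe_le_coe.2 (hΔ.1 (mem_range_self w))
    have : (Δ w : ℝ) * (S.wordRatio w * (radius E).toReal) ≤
        δ * (S.wordRatio w * (radius E).toReal) := by gcongr
    linarith
  refine (ediam_le_of_shapeDifference_lt hlt).trans ?_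
  rw [add_mul (Metric.ediam E).toReal, ENNReal.ofReal_add (by positivity) (by positivity), mul_assoc 2,
    ENNReal.ofReal_mul zero_le_two, ENNReal.ofReal_ofNat]
  gcongr
  refine (S.ediam_wordMap_image_le w E).trans_eq ?_
  rw [mul_comm, ENNReal.ofReal_mul ENNReal.toReal_nonneg, ENNReal.ofReal_toReal hE]

lemma IsStructureSystem.exists_forall_mem_wordPrefix (h : IsStructureSystem 𝓕 F)
    {x : EuclideanSpace ℝ (Fin n)} (hx : x ∈ F) :
    ∃ α : ℕ → Fin m, ∀ k, x ∈ 𝓕 (wordPrefix α k) := by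
  have step : ∀ w : {w // x ∈ 𝓕 w}, ∃ i, x ∈ 𝓕 (w.1 ++ [i]) := fun w => by
    have := w.2
    rwa [h.eq_iUnion, mem_iUnion] at this
  choose next hnext using step
  let u : ℕ → {w // x ∈ 𝓕 w} := fun k =>
    Nat.rec ⟨[], h.root ▸ hx⟩ (fun _ w => ⟨w.1 ++ [next w], hnext w⟩) k
  refine ⟨fun k => next (u k), fun k => ?_⟩
  have : wordPrefix (fun k => next (u k)) k = (u k).1 := by
    induction k with
    | zero => rfl
    | succ k ih => rw [wordPrefix_succ, ih]
  rw [this]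
  exact (u k).2

/-- The coding map of a structure system with shrinking pieces. -/
lemma IsStructureSystem.exists_continuous_coding (h : IsStructureSystem 𝓕 F) {K : ℝ}
    (hdiam : ∀ w, Metric.ediam (𝓕 w) ≤ ENNReal.ofReal (K * S.wordRatio w)) :
    ∃ π : (ℕ → Fin m) → EuclideanSpace ℝ (Fin n), Continuous π ∧
      ∀ α k, π α ∈ 𝓕 (wordPrefix α k) := by
  have hne : ∀ α : ℕ → Fin m, (⋂ k, 𝓕 (wordPrefix α k)).Nonempty := fun α => by
    refine IsCompact.nonempty_iInter_of_sequence_nonempty_isCompact_isClosed _ (fun k => ?_)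
      (fun k => h.nonempty _) (h.isCompact _) fun k => (h.isCompact _).isClosed
    rw [wordPrefix_succ, h.eq_iUnion (wordPrefix α k)]
    exact subset_iUnion (fun i => 𝓕 (wordPrefix α k ++ [i])) (α k)
  choose π hπ using hne
  have hmem : ∀ α k, π α ∈ 𝓕 (wordPrefix α k) := fun α k => mem_iInter.1 (hπ α) k
  refine ⟨π, continuous_iff_continuousAt.2 fun α => ?_, hmem⟩
  refine EMetric.tendsto_nhds.2 fun ε hε => ?_
  have hlim : Tendsto (fun k => ENNReal.ofReal (K * S.wordRatio (wordPrefix α k))) atTop (𝓝 0) := by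
    simpa using ENNReal.tendsto_ofReal ((S.tendsto_wordRatio_wordPrefix α).const_mul K)
  obtain ⟨k, hk⟩ := (hlim.eventually_lt_const hε).exists
  -- Words agreeing in their first `k` letters form a neighbourhood, and their images lie in one
  -- piece of diameter below ε.
  have hev : ∀ᶠ β in 𝓝 α, ∀ j ∈ Finset.range k, β j = α j := by
    rw [Filter.eventually_all_finset]
    intro j _
    exact (continuous_apply j).continuousAt.eventually ((isOpen_discrete {α j}).mem_nhds rfl)
  filter_upwards [hev] with β hβ
  have hpre : wordPrefix β k = wordPrefix α k :=
    wordPrefix_congr fun j hj => hβ j (Finset.mem_range.2 hj)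
  exact (Metric.edist_le_ediam_of_mem (hpre ▸ hmem β k) (hmem α k)).trans_lt
    ((hdiam _).trans_lt hk)

/-! ### Counting pieces at a given scale. -/

/-- Under the open set condition, a set of diameter at most `ρ` meets a bounded number of the
pieces of size about `ρ`. -/
lemma OpenSetCondition.exists_card_le [Nonempty (Fin m)] (h : OpenSetCondition S 𝓕) :
    ∃ N : ℝ, 0 < N ∧ ∀ ρ, 0 < ρ → ∀ U : Set (EuclideanSpace ℝ (Fin n)),
      Metric.ediam U ≤ ENNReal.ofReal ρ → ∀ Q : Finset (List (Fin m)),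
      (∀ w ∈ Q, w ∈ S.stoppingWords ρ ∧ (𝓕 w ∩ U).Nonempty) → (Q.card : ℝ) ≤ N := by
  obtain ⟨V, hVo, hFV, hVd, a₁, a₂, ha₁, ha₂, hV⟩ := h
  obtain ⟨c, hc, hcρ⟩ := S.exists_mul_le_wordRatio_of_mem_stoppingWords
  choose x hx using fun w => (hV w).1
  choose y hy using fun w => (hV w).2
  -- Volume ratio of a ball of radius (1 + 2a₂)ρ about a point of U to the disjoint balls of radius
  -- a₁cρ inside the sets V_w.
  refine ⟨((1 + 2 * a₂) / (a₁ * c)) ^ n, by positivity, fun ρ hρ U hU Q hQ => ?_⟩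
  obtain rfl | ⟨w₀, hw₀⟩ := Q.eq_empty_or_nonempty
  · simpa using (show 0 ≤ ((1 + 2 * a₂) / (a₁ * c)) ^ n by positivity)
  obtain ⟨u₀, -, hu₀⟩ := (hQ w₀ hw₀).2
  have hsub : ∀ w ∈ Q, Metric.ball (x w) (a₁ * c * ρ) ⊆ V w := fun w hw =>
    (Metric.ball_subset_ball (by
      rw [mul_assoc]
      exact mul_le_mul_of_nonneg_left (hcρ ρ w (hQ w hw).1) ha₁.le)).trans (hx w)
  have hV₀ : ∀ w ∈ Q, V w ⊆ Metric.closedBall u₀ ((1 + 2 * a₂) * ρ) := fun w hw v hv => by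
    obtain ⟨⟨-, -, -, hwρ, -⟩, u, huF, huU⟩ := hQ w hw
    have hle : a₂ * S.wordRatio w ≤ a₂ * ρ := mul_le_mul_of_nonneg_left hwρ ha₂.le
    have hu : dist u (y w) ≤ a₂ * S.wordRatio w :=
      closure_minimal (hy w) Metric.isClosed_closedBall (hFV w huF)
    have hvy : dist v (y w) ≤ a₂ * S.wordRatio w := hy w hv
    have huu : dist u u₀ ≤ ρ := by
      have := (Metric.edist_le_ediam_of_mem huU hu₀).trans hU
      rwa [edist_dist, ENNReal.ofReal_le_ofReal_iff hρ.le] at this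
    rw [Metric.mem_closedBall]
    have := dist_triangle v (y w) u₀
    have := dist_triangle (y w) u u₀
    rw [dist_comm (y w) u] at this
    linarith
  have hdisj : (Q : Set (List (Fin m))).PairwiseDisjoint
      fun w => Metric.ball (x w) (a₁ * c * ρ) := fun v hv w hw hvw =>
    (disjoint_iff_inter_eq_empty.2 <| hVd v w <| disjoint_iff_inter_eq_empty.1 <|
      S.disjoint_cylinder_of_mem_stoppingWords (hQ v hv).1 (hQ w hw).1 hvw).mono
        (hsub v hv) (hsub w hw)
  have hvol : ∑ w ∈ Q, volume (Metric.ball (x w) (a₁ * c * ρ)) ≤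
      volume (Metric.closedBall u₀ ((1 + 2 * a₂) * ρ)) := by
    rw [← measure_biUnion_finset hdisj fun _ _ => measurableSet_ball]
    exact measure_mono (iUnion₂_subset fun w hw => (hsub w hw).trans (hV₀ w hw))
  have hβ : volume (Metric.ball (0 : EuclideanSpace ℝ (Fin n)) 1) ≠ 0 :=
    (Metric.measure_ball_pos _ _ one_pos).ne'
  have hβ' : volume (Metric.ball (0 : EuclideanSpace ℝ (Fin n)) 1) ≠ ⊤ := measure_ball_lt_top.ne
  simp only [Measure.addHaar_ball_of_pos volume _ (show 0 < a₁ * c * ρ by positivity),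
    Measure.addHaar_closedBall volume _ (show 0 ≤ (1 + 2 * a₂) * ρ by positivity),
    Finset.sum_const, nsmul_eq_mul, finrank_euclideanSpace, Fintype.card_fin] at hvol
  rw [← mul_assoc, ENNReal.mul_le_mul_iff_left hβ hβ', ← ENNReal.ofReal_natCast,
    ← ENNReal.ofReal_mul (Nat.cast_nonneg _), ENNReal.ofReal_le_ofReal_iff (by positivity),
    mul_pow _ ρ, mul_pow _ ρ, ← mul_assoc, mul_le_mul_iff_left₀ (by positivity)] at hvol
  rwa [div_pow, le_div_iff₀ (by positivity)]

lemma IsStructureSystem.subset_iUnion_stoppingWords (h : IsStructureSystem 𝓕 F) {ρ : ℝ}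
    (h₀ : 0 < ρ) (h₁ : ρ < 1) : F ⊆ ⋃ w : S.stoppingWords ρ, 𝓕 w := fun x hx => by
  obtain ⟨α, hα⟩ := h.exists_forall_mem_wordPrefix hx
  obtain ⟨k, hk⟩ := S.exists_wordPrefix_mem_stoppingWords α h₀ h₁
  exact mem_iUnion.2 ⟨⟨_, hk⟩, hα k⟩

lemma IFSS.tsum_stoppingWords_le (S : IFSS n m) {s : ℝ} (hs : ∑ i, S.ratio i ^ s = 1) (ρ : ℝ) :
    ∑' w : S.stoppingWords ρ, ENNReal.ofReal (S.wordRatio w ^ s) ≤ 1 := by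
  obtain ⟨P, hP, hPc⟩ := S.exists_bernoulli_measure hs
  simp only [← hPc]
  rw [← measure_iUnion (fun v w hvw => S.disjoint_cylinder_of_mem_stoppingWords v.2 w.2
    (Subtype.coe_injective.ne hvw)) fun w => measurableSet_cylinder _]
  exact prob_le_one

/-- Each stopping word has weight at least (cρ)^s and the weights sum to at most 1. The uniform
bound on finite subsets also yields finiteness. -/
lemma IFSS.exists_card_stoppingWords_le [Nonempty (Fin m)] (S : IFSS n m) {s : ℝ}
    (hs : ∑ i, S.ratio i ^ s = 1) :
    ∃ C, 0 < C ∧ ∀ ρ, 0 < ρ → ∃ Q : Finset (List (Fin m)),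
      (Q : Set (List (Fin m))) = S.stoppingWords ρ ∧ (Q.card : ℝ) ≤ C * ρ ^ (-s) := by
  obtain ⟨c, hc, hcρ⟩ := S.exists_mul_le_wordRatio_of_mem_stoppingWords
  have hs₀ := S.nonneg_of_sum_rpow_eq_one hs
  refine ⟨c ^ (-s), by positivity, fun ρ hρ => ?_⟩
  have hcard : ∀ Q : Finset (S.stoppingWords ρ), (Q.card : ℝ) ≤ c ^ (-s) * ρ ^ (-s) := fun Q => by
    have h₁ : ∑ _w ∈ Q, ENNReal.ofReal ((c * ρ) ^ s) ≤ 1 :=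
      (Finset.sum_le_sum fun (w : S.stoppingWords ρ) _ => ENNReal.ofReal_le_ofReal
        (Real.rpow_le_rpow (by positivity) (hcρ ρ w w.2) hs₀)).trans
        ((ENNReal.sum_le_tsum Q).trans (S.tsum_stoppingWords_le hs ρ))
    rw [Finset.sum_const, nsmul_eq_mul, ← ENNReal.ofReal_natCast,
      ← ENNReal.ofReal_mul (Nat.cast_nonneg _), ENNReal.ofReal_le_one,
      ← le_div_iff₀ (by positivity), one_div, ← Real.rpow_neg (by positivity)] at h₁
    rwa [← Real.mul_rpow hc.le hρ.le]
  have hfin : (S.stoppingWords ρ).Finite := by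
    by_contra hinf
    have : Infinite (S.stoppingWords ρ) := Set.infinite_coe_iff.2 hinf
    obtain ⟨N, hN⟩ := exists_nat_gt (c ^ (-s) * ρ ^ (-s))
    obtain ⟨Q, hQ⟩ := Infinite.exists_subset_card_eq (S.stoppingWords ρ) N
    have := hcard Q
    rw [hQ] at this
    linarith
  refine ⟨hfin.toFinset, hfin.coe_toFinset, ?_⟩
  have : Fintype (S.stoppingWords ρ) := hfin.fintype
  have h₂ := hcard Finset.univ
  rwa [Finset.card_univ, ← Set.toFinset_card, ← hfin.toFinset_eq_toFinset] at h₂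

/-! ### The natural measure and the Hausdorff measure. -/

/-- The natural measure on a quasi-self-similar set satisfying the open set condition. -/
lemma exists_measure_le_of_ediam_le [Nonempty (Fin m)] (h : IsStructureSystem 𝓕 F)
    (hO : OpenSetCondition S 𝓕) {K : ℝ}
    (hdiam : ∀ w, Metric.ediam (𝓕 w) ≤ ENNReal.ofReal (K * S.wordRatio w)) {s : ℝ}
    (hs : ∑ i, S.ratio i ^ s = 1) :
    ∃ (μ : Measure (EuclideanSpace ℝ (Fin n))) (C : ℝ), 0 < C ∧ 1 ≤ μ F ∧
      ∀ ρ, 0 < ρ → ρ < 1 → ∀ U : Set (EuclideanSpace ℝ (Fin n)),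
        Metric.ediam U ≤ ENNReal.ofReal ρ → μ U ≤ ENNReal.ofReal (C * ρ ^ s) := by
  obtain ⟨P, hP, hPc⟩ := S.exists_bernoulli_measure hs
  obtain ⟨π, hπc, hπ⟩ := h.exists_continuous_coding hdiam
  obtain ⟨N, hN, hNQ⟩ := hO.exists_card_le
  obtain ⟨_, _, hfin⟩ := S.exists_card_stoppingWords_le hs
  have hs₀ := S.nonneg_of_sum_rpow_eq_one hs
  have hπF : ∀ α, π α ∈ F := fun α => h.root ▸ hπ α 0
  -- Closed sets are measurable, so `Measure.map_apply` applies; a general set is replaced by its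
  -- closure, of equal diameter.
  have hclosed : ∀ ρ, 0 < ρ → ρ < 1 → ∀ U : Set (EuclideanSpace ℝ (Fin n)), IsClosed U →
      Metric.ediam U ≤ ENNReal.ofReal ρ → P.map π U ≤ ENNReal.ofReal (N * ρ ^ s) := by
    intro ρ h₀ h₁ U hUc hU
    classical
    obtain ⟨Q, hQ, -⟩ := hfin ρ h₀
    let Q' := Q.filter fun w => (𝓕 w ∩ U).Nonempty
    have hQmem : ∀ w, w ∈ Q ↔ w ∈ S.stoppingWords ρ := fun w => by
      rw [← hQ, Finset.mem_coe]
    have hQ' : (Q'.card : ℝ) ≤ N := hNQ ρ h₀ U hU Q' fun w hw =>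
      ⟨(hQmem w).1 (Finset.mem_filter.1 hw).1, (Finset.mem_filter.1 hw).2⟩
    have hcover : π ⁻¹' U ⊆ ⋃ w ∈ Q', cylinder w := fun α hα => by
      obtain ⟨k, hk⟩ := S.exists_wordPrefix_mem_stoppingWords α h₀ h₁
      exact mem_iUnion₂.2 ⟨_, Finset.mem_filter.2 ⟨(hQmem _).2 hk, _, hπ α k, hα⟩,
        mem_cylinder_wordPrefix α k⟩
    rw [Measure.map_apply hπc.measurable hUc.measurableSet]
    calc P (π ⁻¹' U) ≤ ∑ w ∈ Q', P (cylinder w) :=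
          (measure_mono hcover).trans (measure_biUnion_finset_le _ _)
      _ ≤ ∑ _w ∈ Q', ENNReal.ofReal (ρ ^ s) := Finset.sum_le_sum fun w hw => by
          obtain ⟨-, -, -, hwρ, -⟩ := (hQmem w).1 (Finset.mem_filter.1 hw).1
          rw [hPc]
          exact ENNReal.ofReal_le_ofReal (Real.rpow_le_rpow (S.wordRatio_pos w).le hwρ hs₀)
      _ ≤ ENNReal.ofReal (N * ρ ^ s) := by
          rw [Finset.sum_const, nsmul_eq_mul, ← ENNReal.ofReal_natCast,
            ← ENNReal.ofReal_mul (Nat.cast_nonneg _)]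
          exact ENNReal.ofReal_le_ofReal (by gcongr)
  refine ⟨P.map π, N, hN, ?_, fun ρ h₀ h₁ U hU => ?_⟩
  · have hFc : IsClosed F := h.root ▸ (h.isCompact []).isClosed
    rw [Measure.map_apply hπc.measurable hFc.measurableSet,
      eq_univ_of_forall (s := π ⁻¹' F) hπF, measure_univ]
  · exact (measure_mono subset_closure).trans
      (hclosed ρ h₀ h₁ _ isClosed_closure (by rwa [Metric.ediam_closure]))

lemma hausdorffMeasure_lt_top_of_ediam_le (h : IsStructureSystem 𝓕 F) {K : ℝ} (hK : 0 < K)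
    (hdiam : ∀ w, Metric.ediam (𝓕 w) ≤ ENNReal.ofReal (K * S.wordRatio w)) {s : ℝ}
    (hs : ∑ i, S.ratio i ^ s = 1) : μH[s] F < ⊤ := by
  have hs₀ := S.nonneg_of_sum_rpow_eq_one hs
  -- The exponent j + 1 keeps every scale below 1.
  let ρ : ℕ → ℝ := fun j => (1 / 2) ^ (j + 1)
  have hρ₀ : ∀ j, 0 < ρ j := fun j => by positivity
  have hρ₁ : ∀ j, ρ j < 1 := fun j => pow_lt_one₀ (by norm_num) (by norm_num) (by simp)
  have hlim : Tendsto (fun j => ENNReal.ofReal (K * ρ j)) atTop (𝓝 0) := by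
    have : Tendsto ρ atTop (𝓝 0) := (tendsto_add_atTop_iff_nat 1).2
      (tendsto_pow_atTop_nhds_zero_of_lt_one (r := (1 / 2 : ℝ)) (by norm_num) (by norm_num))
    simpa using ENNReal.tendsto_ofReal (this.const_mul K)
  have hsum : ∀ j, ∑' w : S.stoppingWords (ρ j), Metric.ediam (𝓕 w) ^ s ≤
      ENNReal.ofReal (K ^ s) := fun j => by
    calc ∑' w : S.stoppingWords (ρ j), Metric.ediam (𝓕 w) ^ s
        ≤ ∑' w : S.stoppingWords (ρ j),
          ENNReal.ofReal (K ^ s) * ENNReal.ofReal (S.wordRatio w ^ s) := by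
          refine ENNReal.tsum_le_tsum fun w => ?_
          have hc := S.wordRatio_pos w
          refine (ENNReal.rpow_le_rpow (hdiam w) hs₀).trans_eq ?_
          rw [ENNReal.ofReal_rpow_of_pos (by positivity), Real.mul_rpow hK.le hc.le,
            ENNReal.ofReal_mul (by positivity)]
      _ ≤ ENNReal.ofReal (K ^ s) := by
          rw [ENNReal.tsum_mul_left]
          exact mul_le_of_le_one_right zero_le (S.tsum_stoppingWords_le hs _)
  refine (Measure.hausdorffMeasure_le_liminf_tsum s F _ hlim
    (fun j (w : S.stoppingWords (ρ j)) => 𝓕 w) (.of_forall fun j w => ?_)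
    (.of_forall fun j => h.subset_iUnion_stoppingWords (hρ₀ j) (hρ₁ j))).trans_lt ?_
  · obtain ⟨-, -, -, hw, -⟩ := w.2
    exact (hdiam w).trans (ENNReal.ofReal_le_ofReal (by gcongr))
  · exact (liminf_le_of_frequently_le' (Frequently.of_forall hsum)).trans_lt ENNReal.ofReal_lt_top

/-- The mass distribution principle: μ/C is dominated by the Hausdorff measure. -/
lemma hausdorffMeasure_pos_of_measure_le {X : Type*} [EMetricSpace X] [MeasurableSpace X]
    [BorelSpace X] {F : Set X} {s C : ℝ} (hs : 0 ≤ s) (hC : 0 < C) {μ : Measure X} (hμF : μ F ≠ 0)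
    (hμ : ∀ ρ, 0 < ρ → ρ < 1 → ∀ U : Set X, Metric.ediam U ≤ ENNReal.ofReal ρ →
      μ U ≤ ENNReal.ofReal (C * ρ ^ s)) : 0 < μH[s] F := by
  have hle : ENNReal.ofReal C⁻¹ • μ ≤ μH[s] := by
    refine Measure.le_hausdorffMeasure s _ (ENNReal.ofReal (1 / 2)) (by simp) fun U hU => ?_
    have hbound : ∀ ρ, 0 < ρ → ρ < 1 → Metric.ediam U ≤ ENNReal.ofReal ρ →
        (ENNReal.ofReal C⁻¹ • μ) U ≤ ENNReal.ofReal (ρ ^ s) := fun ρ h₀ h₁ hρ => by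
      rw [Measure.smul_apply, smul_eq_mul]
      refine (mul_le_mul_right (hμ ρ h₀ h₁ U hρ) _).trans_eq ?_
      rw [← ENNReal.ofReal_mul (by positivity), inv_mul_cancel_left₀ hC.ne']
    have htop : Metric.ediam U ≠ ⊤ := ne_top_of_le_ne_top ENNReal.ofReal_ne_top hU
    -- At diameter 0 no scale ρ > 0 equals the diameter: for s = 0 any scale serves since 0^0 = 1,
    -- and for s > 0 one lets ρ tend to 0.
    obtain hzero | hpos := eq_or_ne (Metric.ediam U) 0
    · obtain rfl | hs' := hs.eq_or_lt
      · simpa using hbound (1 / 2) (by norm_num) (by norm_num) hU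
      · rw [hzero, ENNReal.zero_rpow_of_pos hs']
        have hlim : Tendsto (fun ρ : ℝ => ENNReal.ofReal (ρ ^ s)) (𝓝[>] 0) (𝓝 0) := by
          have := (Real.continuousAt_rpow_const 0 s (.inr hs)).tendsto
          rw [Real.zero_rpow hs'.ne'] at this
          simpa using ENNReal.tendsto_ofReal (this.mono_left nhdsWithin_le_nhds)
        refine ge_of_tendsto hlim ?_
        filter_upwards [Ioo_mem_nhdsGT (zero_lt_one' ℝ)] with ρ hρ
        exact hbound ρ hρ.1 hρ.2 (by simp [hzero])
    · have hpos' := ENNReal.toReal_pos hpos htop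
      have := hbound (Metric.ediam U).toReal hpos'
        (((ENNReal.toReal_le_of_le_ofReal (by norm_num) hU)).trans_lt (by norm_num))
        (ENNReal.ofReal_toReal htop).ge
      rwa [← ENNReal.ofReal_rpow_of_pos hpos', ENNReal.ofReal_toReal htop] at this
  refine lt_of_lt_of_le ?_ (hle F)
  rw [Measure.smul_apply, smul_eq_mul]
  exact ENNReal.mul_pos (by simpa using hC) hμF

/-! ### Box dimension. -/

lemma hasBoxDim_of_coverCount_bounds {X : Type*} [PseudoEMetricSpace X] {A : Set X}
    {s c C : ℝ} (hc : 0 < c) (hC : 0 < C)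
    (h : ∀ᶠ r in 𝓝[>] (0 : ℝ), ∃ k : ℕ, coverCount A r = k ∧ c * r ^ (-s) ≤ k ∧
      (k : ℝ) ≤ C * r ^ (-s)) : HasBoxDim A s := by
  have hlog : Tendsto (fun r : ℝ => -Real.log r) (𝓝[>] 0) atTop :=
    tendsto_neg_atBot_atTop.comp Real.tendsto_log_nhdsGT_zero
  have haux : ∀ b : ℝ, Tendsto (fun r : ℝ => Real.log b / (-Real.log r) + s) (𝓝[>] 0) (𝓝 s) :=
    fun b => by simpa using (hlog.const_div_atTop (Real.log b)).add_const s
  have hpos : ∀ᶠ r in 𝓝[>] (0 : ℝ), 0 < r ∧ r < 1 := Ioo_mem_nhdsGT zero_lt_one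
  have hval : ∀ b r : ℝ, 0 < b → 0 < r → r < 1 →
      Real.log (b * r ^ (-s)) / (-Real.log r) = Real.log b / (-Real.log r) + s := by
    intro b r hb h₀ h₁
    have := (Real.log_neg h₀ h₁).ne
    rw [Real.log_mul hb.ne' (by positivity), Real.log_rpow h₀]
    field_simp
    ring
  have hreal : Tendsto (fun r : ℝ => Real.log (coverCount A r : ℝ≥0∞).toReal / (-Real.log r))
      (𝓝[>] 0) (𝓝 s) := by
    refine tendsto_of_tendsto_of_tendsto_of_le_of_le' (haux c) (haux C) ?_ ?_
    · filter_upwards [h, hpos] with r ⟨k, hk, h₁, _⟩ hr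
      have := Real.log_neg hr.1 hr.2
      have hr₀ := hr.1
      rw [← hval c r hc hr.1 hr.2, hk, ENat.toENNReal_coe, ENNReal.toReal_natCast]
      gcongr
      linarith
    · filter_upwards [h, hpos] with r ⟨k, hk, h₁, h₂⟩ hr
      have := Real.log_neg hr.1 hr.2
      have hr₀ := hr.1
      have hk₀ : (0 : ℝ) < k := lt_of_lt_of_le (by positivity) h₁
      rw [← hval C r hC hr.1 hr.2, hk, ENat.toENNReal_coe, ENNReal.toReal_natCast]
      gcongr
      linarith
  have hlim : Tendsto (fun r : ℝ => ENNReal.log (coverCount A r : ℝ≥0∞) /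
      ((-Real.log r : ℝ) : EReal)) (𝓝[>] 0) (𝓝 s) := by
    refine (EReal.tendsto_coe.2 hreal).congr' ?_
    filter_upwards [h, hpos] with r ⟨k, hk, h₁, _⟩ hr
    have hr₀ := hr.1
    have hk₀ : (0 : ℝ) < k := lt_of_lt_of_le (by positivity) h₁
    rw [EReal.coe_div, ENNReal.log_pos_real']
    simpa [hk] using hk₀
  exact ⟨hlim.liminf_eq, hlim.limsup_eq⟩

lemma eventually_coverCount_bounds [Nonempty (Fin m)] (h : IsStructureSystem 𝓕 F)
    (hO : OpenSetCondition S 𝓕) {K : ℝ} (hK : 0 < K)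
    (hdiam : ∀ w, Metric.ediam (𝓕 w) ≤ ENNReal.ofReal (K * S.wordRatio w)) {s : ℝ}
    (hs : ∑ i, S.ratio i ^ s = 1) :
    ∃ c C : ℝ, 0 < c ∧ 0 < C ∧ ∀ᶠ r in 𝓝[>] (0 : ℝ), ∃ k : ℕ, coverCount F r = k ∧
      c * r ^ (-s) ≤ k ∧ (k : ℝ) ≤ C * r ^ (-s) := by
  obtain ⟨μ, C₁, hC₁, hμF, hμ⟩ := exists_measure_le_of_ediam_le h hO hdiam hs
  obtain ⟨C₂, hC₂, hQ⟩ := S.exists_card_stoppingWords_le hs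
  refine ⟨C₁⁻¹, C₂ * K ^ s, by positivity, by positivity, ?_⟩
  -- r < 1 serves the mass bound, r < K the stopping cover at scale r/K, whose pieces have diameter
  -- at most r.
  filter_upwards [Ioo_mem_nhdsGT (lt_min zero_lt_one hK)] with r hr
  have hr₀ : 0 < r := hr.1
  have hr₁ : r < 1 := hr.2.trans_le (min_le_left _ _)
  have hrK : r / K < 1 := (div_lt_one hK).2 (hr.2.trans_le (min_le_right _ _))
  classical
  obtain ⟨Q, hQe, hQc⟩ := hQ (r / K) (by positivity)
  have hupper : coverCount F r ≤ Q.card := by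
    refine (iInf₂_le_of_le (Q.image 𝓕) ?_ (iInf_le _ ?_)).trans
      (Nat.cast_le.2 Finset.card_image_le)
    · refine (h.subset_iUnion_stoppingWords (S := S) (ρ := r / K) (by positivity) hrK).trans
        (iUnion_subset fun w => ?_)
      exact subset_biUnion_of_mem (u := id) (Finset.mem_coe.2
        (Finset.mem_image_of_mem 𝓕 (Finset.mem_coe.1 (hQe.symm.subset w.2))))
    · simp only [Finset.mem_image]
      rintro _ ⟨w, hw, rfl⟩
      obtain ⟨-, -, -, hwρ, -⟩ : w ∈ S.stoppingWords (r / K) := hQe.subset hw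
      refine (hdiam w).trans (ENNReal.ofReal_le_ofReal ?_)
      rwa [le_div_iff₀ hK, mul_comm] at hwρ
  have hne : coverCount F r ≠ ⊤ := ne_top_of_le_ne_top (ENat.natCast_ne_top _) hupper
  obtain ⟨k, hk⟩ := ENat.ne_top_iff_exists.1 hne
  -- The ceiling turns the real bound into one in `ℕ∞`, provable cover by cover.
  have hlower : ((⌈C₁⁻¹ * r ^ (-s)⌉₊ : ℕ) : ℕ∞) ≤ coverCount F r := by
    refine le_iInf₂ fun 𝒰 h𝒰 => le_iInf fun hd => Nat.cast_le.2 (Nat.ceil_le.2 ?_)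
    have h₁ : (1 : ℝ≥0∞) ≤ ∑ _U ∈ 𝒰, ENNReal.ofReal (C₁ * r ^ s) :=
      hμF.trans <| (measure_mono h𝒰).trans <| (measure_biUnion_finset_le _ _).trans <|
        Finset.sum_le_sum fun U hU => hμ r hr₀ hr₁ U (hd U hU)
    rw [Finset.sum_const, nsmul_eq_mul, ← ENNReal.ofReal_natCast,
      ← ENNReal.ofReal_mul (Nat.cast_nonneg _), ENNReal.one_le_ofReal] at h₁
    rw [Real.rpow_neg hr₀.le, ← mul_inv]
    exact (inv_le_iff_one_le_mul₀ (by positivity)).2 h₁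
  refine ⟨k, hk.symm, ?_, ?_⟩
  · rw [← hk, Nat.cast_le] at hlower
    exact Nat.ceil_le.1 hlower
  · rw [← hk, Nat.cast_le] at hupper
    refine (Nat.cast_le.2 hupper).trans (hQc.trans_eq ?_)
    rw [Real.div_rpow hr₀.le hK.le, Real.rpow_neg hK.le, div_inv_eq_mul]
    ring

end ShapePerturbation

end

theorem theorem3p2p4 {n m : ℕ} (S : ShapePerturbation.IFSS n m)
    (E F : Set (EuclideanSpace ℝ (Fin n)))
    (𝓕 : List (Fin m) → Set (EuclideanSpace ℝ (Fin n))) (δ : ℝ≥0)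
    (hF : ShapePerturbation.IsQuasiSelfSimilar S E F 𝓕 δ)
    (hO : ShapePerturbation.OpenSetCondition S 𝓕)
    (s : ℝ) (hs : ∑ i, S.ratio i ^ s = 1) :
    (dimH F : EReal) = (s : EReal) ∧
      ShapePerturbation.HasBoxDim F (s : EReal) ∧
      0 < μH[s] F ∧ μH[s] F < ⊤ := by
  have : Nonempty (Fin m) := by
    by_contra h
    rw [not_nonempty_iff] at h
    simp at hs
  obtain ⟨K, hK, hdiam⟩ := hF.exists_ediam_le
  obtain ⟨_, _, hP⟩ := hF
  have hst := hP.structureSystem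
  have hs₀ := S.nonneg_of_sum_rpow_eq_one hs
  obtain ⟨μ, C, hC, hμF, hμ⟩ :=
    ShapePerturbation.exists_measure_le_of_ediam_le hst hO hdiam hs
  have hpos : 0 < μH[s] F := ShapePerturbation.hausdorffMeasure_pos_of_measure_le hs₀ hC
    (zero_lt_one.trans_le hμF).ne' hμ
  have hfin : μH[s] F < ⊤ :=
    ShapePerturbation.hausdorffMeasure_lt_top_of_ediam_le hst hK hdiam hs
  obtain ⟨c₁, c₂, hc₁, hc₂, hcount⟩ :=
    ShapePerturbation.eventually_coverCount_bounds hst hO hK hdiam hs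
  refine ⟨?_, ShapePerturbation.hasBoxDim_of_coverCount_bounds hc₁ hc₂ hcount, hpos, hfin⟩
  lift s to ℝ≥0 using hs₀
  rw [dimH_of_hausdorffMeasure_ne_zero_ne_top hpos.ne' hfin.ne]
  rfl
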